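/- Let $(\Omega,\mathscr F,\mathbb P)$ be a probability space with a filtration $\mathbb F=(\mathscr F_t)_{t\ge 0}$ satisfying the usual conditions, $\mathscr F_0$ being the $\mathbb P$-augmentation of the trivial $\sigma$-algebra. For a làdlàg process $Z$ let $Z_-$ denote its process of left limits, with $Z_{0-}=Z_0$; limits $s\downarrow t$ are taken over $s>t$; processes are identified up to evanescence. Put $Y=\mathbf 1_{[1,\infty)}$ and $X^n=\mathbf 1_{[1+1/n,\infty)}$ for $n\ge 1$ (deterministic processes). Then $Y$ and all $X^n$ are semimartingales, $X^n_0=0$, and: 1. $\sup_n\mathbb E[\mathrm{var}(X^n)_\infty]\le 1$. 2. For every choice of $\widetilde X^n\in\mathrm{co}\{X^m:m\ge n\}$ ($n\geq 1$), $Y=\lim_{s\downarrow\cdot,\,s\in\mathbb Q_+}\lim_{n\to\infty}\widetilde X^n_s$, the inner limits being $\mathbb P$-a.s. limits. 3. For every such choice, the integrals $\int_0^\cdot Y_-\,d\widetilde X^n_-$ and $\int_0^\cdot Y_-\,dY$ exist, the limit $\lim_{s\downarrow\cdot,\,s\in\mathbb Q_+}\lim_{n\to\infty}\int_0^s Y_-\,d\widetilde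 X^n_-$ exists, and $$\lim_{s\downarrow\cdot,\,s\in\mathbb Q_+}\lim_{n\to\infty}\int_0^s Y_-\,d\widetilde X^n_-\neq\int_0^\cdot Y_-\,dY .$$ The same holds with $\int_0^s Y_-\,d\widetilde X^n$ in place of $\int_0^s Y_-\,d\widetilde X^n_-$. (For a càdlàg $X$ and a simple predictable integrand, integration against $dX_-$ over $[0,s]$ means integration against $dX$ over $[0,s)$; both kinds of integrals extend to left-continuous integrands by continuity in the topology of uniform convergence on compacts in probability.) 4. Consequently, for no such choice is there a semimartingale $\widetilde X$ with $\widetilde X=\lim_{s\downarrow\cdot,\,s\in\mathbb Q_+}\lim_{n\to\infty}\widetilde X^n_s$ and $$\lim_{s\downarrow\cdot,\,s\in\mathbb Q_+}\mathbb P\text{-}\lim_{n\to\infty}\int_0^s Y_-\,d\widetilde X^n=\int_0^\cdot Y_-\,d\widetilde X,$$ where $\mathbb P\text{-}\lim$ is the limit in probability. -/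

import Mathlib

open MeasureTheory ProbabilityTheory Filter Topology
open scoped NNReal ENNReal

noncomputable section

namespace FatouIto

/-- Real-valued stochastic processes indexed by `[0, ∞)`. -/
abbrev StochProcess (Ω : Type*) : Type _ := ℝ≥0 → Ω → ℝ

/-- The usual conditions, together with the requirement that the initial σ-algebra is the
augmentation of the trivial one (it consists exactly of the sets of probability zero or one). -/
structure UsualConditions {Ω : Type*} {m : MeasurableSpace Ω} (𝓕 : Filtration ℝ≥0 m)
    (μ : Measure Ω) : Prop where
  rightCont : ∀ t : ℝ≥0, 𝓕 t = ⨅ s > t, 𝓕 s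
  null_measurable : ∀ s : Set Ω, μ s = 0 → MeasurableSet[𝓕 0] s
  initial_trivial : ∀ s : Set Ω, MeasurableSet[𝓕 0] s → μ s = 0 ∨ μ s = 1

/-- Right-continuous with left limits. -/
def IsCadlag (f : ℝ≥0 → ℝ) : Prop :=
  ∀ t, ContinuousWithinAt f (Set.Ici t) t ∧ ∃ l, Tendsto f (𝓝[<] t) (𝓝 l)

/-- Adapted processes all of whose paths are càdlàg. -/
structure IsCadlagAdapted {Ω : Type*} {m : MeasurableSpace Ω} (𝓕 : Filtration ℝ≥0 m)
    (X : StochProcess Ω) : Prop where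
  adapted : StronglyAdapted 𝓕 X
  cadlag : ∀ ω, IsCadlag fun t => X t ω

/-- Càdlàg local martingales. -/
structure IsLocalMartingale {Ω : Type*} {m : MeasurableSpace Ω} (𝓕 : Filtration ℝ≥0 m)
    (μ : Measure Ω) (M : StochProcess Ω) : Prop extends IsCadlagAdapted 𝓕 M where
  locally_martingale : Locally (fun N : StochProcess Ω => Martingale N 𝓕 μ) 𝓕 M μ

/-- Adapted càdlàg processes with paths of locally finite variation. -/
structure IsFiniteVariation {Ω : Type*} {m : MeasurableSpace Ω} (𝓕 : Filtration ℝ≥0 m)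
    (A : StochProcess Ω) : Prop extends IsCadlagAdapted 𝓕 A where
  finite_variation : ∀ ω, LocallyBoundedVariationOn (fun t => A t ω) Set.univ

/-- Two processes are equal up to an evanescent set. -/
def Indistinguishable {Ω : Type*} {m : MeasurableSpace Ω} (μ : Measure Ω)
    (X Z : StochProcess Ω) : Prop :=
  ∀ᵐ ω ∂μ, ∀ t, X t ω = Z t ω

/-- Semimartingales: adapted càdlàg processes that are the sum of a local martingale and an
adapted process of finite variation. -/
structure IsSemimartingale {Ω : Type*} {m : MeasurableSpace Ω} (𝓕 : Filtration ℝ≥0 m)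
    (μ : Measure Ω) (X : StochProcess Ω) : Prop extends IsCadlagAdapted 𝓕 X where
  decomposition : ∃ M A : StochProcess Ω, IsLocalMartingale 𝓕 μ M ∧ IsFiniteVariation 𝓕 A ∧
    Indistinguishable μ X (M + A)

/-- The process of left limits `X₋`, with `X₋ 0 = X 0`. -/
def leftLimProcess {Ω : Type*} (X : StochProcess Ω) : StochProcess Ω :=
  fun t ω => Function.leftLim (fun s => X s ω) t

/-- The total variation of the path `t ↦ X t ω` on `[0, ∞)`. -/
def totalVariation {Ω : Type*} (X : StochProcess Ω) (ω : Ω) : ℝ≥0∞ :=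
  eVariationOn (fun t => X t ω) Set.univ

/-- Uniform convergence on compacts in probability. For paths with one-sided limits the event below
is, up to the choice of `ε`, the event that the supremum over `[0, t]` is at least `ε`. -/
def TendstoUCP {Ω : Type*} {m : MeasurableSpace Ω} (μ : Measure Ω) (U : ℕ → StochProcess Ω)
    (Z : StochProcess Ω) : Prop :=
  ∀ t : ℝ≥0, ∀ ε : ℝ, 0 < ε →
    Tendsto (fun k => μ {ω | ∃ s ≤ t, ε ≤ |U k s ω - Z s ω|}) atTop (𝓝 0)

/-- Data of a simple predictable process
`c₀ 1_{0} + ∑_{i < n} cᵢ 1_{(Tᵢ, Tᵢ₊₁]}`, with finite stopping times `T₀ ≤ T₁ ≤ ⋯`, an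
`𝓕 0`-measurable `c₀`, and `cᵢ` measurable with respect to the σ-algebra of the past of `Tᵢ`. -/
structure SimplePredictable {Ω : Type*} {m : MeasurableSpace Ω} (𝓕 : Filtration ℝ≥0 m) where
  n : ℕ
  T : ℕ → Ω → ℝ≥0
  mono_T : ∀ ω, Monotone fun i => T i ω
  stopping : ∀ i, IsStoppingTime 𝓕 fun ω => (T i ω : WithTop ℝ≥0)
  c₀ : Ω → ℝ
  measurable_c₀ : Measurable[𝓕 0] c₀
  c : ℕ → Ω → ℝ
  measurable_c : ∀ i, Measurable[(stopping i).measurableSpace] (c i)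

/-- The process defined by the data of a simple predictable process. -/
def SimplePredictable.eval {Ω : Type*} {m : MeasurableSpace Ω} {𝓕 : Filtration ℝ≥0 m}
    (S : SimplePredictable 𝓕) : StochProcess Ω :=
  fun t ω => Set.indicator {0} (fun _ => S.c₀ ω) t +
    ∑ i ∈ Finset.range S.n,
      Set.indicator (Set.Ioc (S.T i ω) (S.T (i + 1) ω)) (fun _ => S.c i ω) t

/-- The path `f` stopped immediately after time `τ`: a right jump of `f` at `τ` is included in the
stopped path on `(τ, ∞)`. For a right-continuous `f` this is `t ↦ f (min t τ)`. -/
def stopAfter (f : ℝ≥0 → ℝ) (τ t : ℝ≥0) : ℝ :=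
  if t ≤ τ then f t else Function.rightLim f τ

/-- The elementary integral `∑_{i < n} cᵢ (A^{Tᵢ₊₁} - A^{Tᵢ})` of a simple predictable process
against an integrator `A` with one-sided limits. For a càdlàg integrator it is the usual
`∑_{i < n} cᵢ (A_{Tᵢ₊₁ ∧ t} - A_{Tᵢ ∧ t})`. In general all jumps of `A` (left and right) at
points of `(Tᵢ, Tᵢ₊₁]` are weighted by `cᵢ`, and a right jump at the current time `t` is not yet
counted, so that for `A = X₋` with `X` càdlàg one integrates `dX` over `[0, t)`. -/
def SimplePredictable.integral {Ω : Type*} {m : MeasurableSpace Ω} {𝓕 : Filtration ℝ≥0 m}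
    (S : SimplePredictable 𝓕) (A : StochProcess Ω) : StochProcess Ω :=
  fun t ω => ∑ i ∈ Finset.range S.n,
    S.c i ω * (stopAfter (fun s => A s ω) (S.T (i + 1) ω) t -
      stopAfter (fun s => A s ω) (S.T i ω) t)

/-- `Z` is (a version of) the Itô integral `∫₀^· H dA`: the integrand `H` belongs to the u.c.p.
closure of the simple predictable processes (these are, up to indistinguishability, the adapted
left-continuous processes with right limits), and `Z` is the value at `H` of the u.c.p.-continuous
extension of the elementary integral. By the first clause `Z` is unique up to
indistinguishability. -/
def IsItoIntegral {Ω : Type*} {m : MeasurableSpace Ω} (𝓕 : Filtration ℝ≥0 m) (μ : Measure Ω)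
    (H A Z : StochProcess Ω) : Prop :=
  (∃ S : ℕ → SimplePredictable 𝓕, TendstoUCP μ (fun k => (S k).eval) H) ∧
    ∀ S : ℕ → SimplePredictable 𝓕, TendstoUCP μ (fun k => (S k).eval) H →
      TendstoUCP μ (fun k => (S k).integral A) Z

/-- `Xt n ∈ co {X m : m ≥ n}` for every `n`. -/
def IsForwardConvexCombination {Ω : Type*} (X Xt : ℕ+ → StochProcess Ω) : Prop :=
  ∀ n, Xt n ∈ convexHull ℝ (X '' Set.Ici n)

/-- `L = lim_{s ↓ ·, s ∈ ℚ₊} ξ s`, almost surely at all times simultaneously. -/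
def IsRationalRightLimit {Ω : Type*} {m : MeasurableSpace Ω} (μ : Measure Ω)
    (ξ : ℚ≥0 → Ω → ℝ) (L : StochProcess Ω) : Prop :=
  ∀ᵐ ω ∂μ, ∀ t : ℝ≥0,
    Tendsto (fun q => ξ q ω) (comap (fun q : ℚ≥0 => (q : ℝ≥0)) (𝓝[>] t)) (𝓝 (L t ω))

/-- `L = lim_{s ↓ ·, s ∈ ℚ₊} lim_{n → ∞} U n s`, the inner limits being almost sure limits. -/
def IsFatouLimit {Ω : Type*} {m : MeasurableSpace Ω} (μ : Measure Ω)
    (U : ℕ+ → StochProcess Ω) (L : StochProcess Ω) : Prop :=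
  ∃ ξ : ℚ≥0 → Ω → ℝ,
    (∀ q : ℚ≥0, ∀ᵐ ω ∂μ, Tendsto (fun n => U n (q : ℝ≥0) ω) atTop (𝓝 (ξ q ω))) ∧
    IsRationalRightLimit μ ξ L

/-- `L = lim_{s ↓ ·, s ∈ ℚ₊} ℙ-lim_{n → ∞} U n s`, the inner limits being limits in probability. -/
def IsFatouLimitInProbability {Ω : Type*} {m : MeasurableSpace Ω} (μ : Measure Ω)
    (U : ℕ+ → StochProcess Ω) (L : StochProcess Ω) : Prop :=
  ∃ ξ : ℚ≥0 → Ω → ℝ,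
    (∀ q : ℚ≥0, TendstoInMeasure μ (fun n => U n (q : ℝ≥0)) atTop (ξ q)) ∧
    IsRationalRightLimit μ ξ L

/-- The deterministic process `1_{[a, ∞)}`. -/
def stepProcess (Ω : Type*) (a : ℝ≥0) : StochProcess Ω :=
  fun t _ => Set.indicator (Set.Ici a) (fun _ => 1) t

end FatouIto

end

open FatouIto

open FatouIto

/-! Since `Y₋ = 1_{(1, ∞)}`, everything depends on where the integrator jumps. `Y` jumps at `1`,
where `Y₋` is still `0`, so `∫ Y₋ dY = 0`. Every `Xt n` jumps only in `(1, 1 + 1/n]`, where `Y₋ =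
1`, so `Xt n` and `(Xt n)₋` are reproduced by the integral. They climb from `0` to `1` just after
`1`, so their Fatou limit is `Y`, which is not `0`. The computation rests on
`SimplePredictable.integral_sum_indicator`: against a finite sum of weighted unit jumps at times `a
i > 0`, the elementary integral sees its integrand only through the values at the `a i`. This gives
u.c.p. continuity and hence the Itô integrals. Since integrals and Fatou limits are unique up to
indistinguishability, the conclusion holds for every version. -/

namespace FatouIto

variable {Ω : Type*} {m : MeasurableSpace Ω} {μ : Measure Ω} {𝓕 : Filtration ℝ≥0 m}

/-! ### One-sided limits and stopping of step paths -/

section Paths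

variable {a : ℝ≥0} {s : Set ℝ≥0}

/-- The sandwich leaves only the value at `a` free, and right limits do not see it. This form treats
a càdlàg step (`s = Ici a`) and its left-limit version (`s = Ioi a`) together. -/
lemma tendsto_indicator_nhdsGT (h₁ : Set.Ioi a ⊆ s) (h₂ : s ⊆ Set.Ici a) (τ : ℝ≥0) :
    Tendsto (s.indicator fun _ => (1 : ℝ)) (𝓝[>] τ)
      (𝓝 ((Set.Ici a).indicator (fun _ => 1) τ)) := by
  by_cases h : a ≤ τ
  · refine tendsto_const_nhds.congr' ?_
    filter_upwards [self_mem_nhdsWithin] with x hx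
    rw [Set.indicator_of_mem (Set.mem_Ici.2 h), Set.indicator_of_mem (h₁ (h.trans_lt hx))]
  · refine tendsto_const_nhds.congr' ?_
    filter_upwards [nhdsWithin_le_nhds (Iio_mem_nhds (not_le.1 h))] with x hx
    have hs : x ∉ s := fun h' => (not_le.2 hx : ¬ a ≤ x) (h₂ h')
    simp [h, hs]

lemma tendsto_indicator_nhdsLT (a t : ℝ≥0) :
    Tendsto ((Set.Ici a).indicator fun _ => (1 : ℝ)) (𝓝[<] t)
      (𝓝 ((Set.Ioi a).indicator (fun _ => 1) t)) := by
  by_cases h : a < t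
  · refine tendsto_const_nhds.congr' ?_
    filter_upwards [nhdsWithin_le_nhds (Ioi_mem_nhds h)] with x hx
    simp [h, (Set.mem_Ioi.1 hx).le]
  · refine tendsto_const_nhds.congr' ?_
    filter_upwards [self_mem_nhdsWithin] with x hx
    have hs : ¬ a ≤ x := fun h' => h (h'.trans_lt hx)
    simp [h, hs]

lemma isCadlag_indicator_Ici (a : ℝ≥0) : IsCadlag ((Set.Ici a).indicator fun _ => (1 : ℝ)) :=
  fun t => ⟨continuousWithinAt_Ioi_iff_Ici.1
    (tendsto_indicator_nhdsGT Set.Ioi_subset_Ici_self subset_rfl t),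
    _, tendsto_indicator_nhdsLT a t⟩

lemma monotone_indicator_Ici (a : ℝ≥0) : Monotone ((Set.Ici a).indicator fun _ => (1 : ℝ)) := by
  intro x y hxy
  by_cases h : a ≤ x
  · rw [Set.indicator_of_mem (Set.mem_Ici.2 h), Set.indicator_of_mem (Set.mem_Ici.2 (h.trans hxy))]
  · rw [Set.indicator_of_notMem (show x ∉ Set.Ici a from h)]
    exact Set.indicator_nonneg (fun _ _ => zero_le_one) _

variable {ι : Type*} [Fintype ι]

lemma leftLim_sum_indicator_Ici (w : ι → ℝ) {a : ι → ℝ≥0} (ha : ∀ i, 0 < a i) (t : ℝ≥0) :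
    Function.leftLim (fun x => ∑ i, w i * (Set.Ici (a i)).indicator (fun _ => (1 : ℝ)) x) t =
      ∑ i, w i * (Set.Ioi (a i)).indicator (fun _ => (1 : ℝ)) t := by
  rcases eq_or_ne t 0 with rfl | ht
  · rw [leftLim_eq_of_isBot fun _ => zero_le]
    refine Finset.sum_congr rfl fun i _ => ?_
    simp [(ha i).ne']
  · have : (𝓝[<] t).NeBot := nhdsLT_neBot_of_exists_lt ⟨0, pos_iff_ne_zero.2 ht⟩
    exact leftLim_eq_of_tendsto
      (tendsto_finsetSum _ fun i _ => (tendsto_indicator_nhdsLT (a i) t).const_mul (w i))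

/-- A jump at `a i` survives stopping after `τ` exactly when `a i ≤ τ`, even if it is a right jump
at `τ` itself. -/
lemma stopAfter_sum_indicator (w : ι → ℝ) {a : ι → ℝ≥0} {s : ι → Set ℝ≥0}
    (h₁ : ∀ i, Set.Ioi (a i) ⊆ s i) (h₂ : ∀ i, s i ⊆ Set.Ici (a i)) (τ t : ℝ≥0) :
    stopAfter (fun x => ∑ i, w i * (s i).indicator (fun _ => (1 : ℝ)) x) τ t =
      ∑ i, w i * ((s i).indicator (fun _ => 1) t * (Set.Ici (a i)).indicator (fun _ => 1) τ) := by
  unfold stopAfter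
  split_ifs with h
  · refine Finset.sum_congr rfl fun i _ => ?_
    by_cases hi : t ∈ s i
    · rw [Set.indicator_of_mem (Set.mem_Ici.2 ((h₂ i hi).trans h)), mul_one]
    · simp [hi]
  · rw [rightLim_eq_of_tendsto (tendsto_finsetSum _ fun i _ =>
      (tendsto_indicator_nhdsGT (h₁ i) (h₂ i) τ).const_mul (w i))]
    refine Finset.sum_congr rfl fun i _ => ?_
    by_cases hi : a i ≤ τ
    · rw [Set.indicator_of_mem (h₁ i (hi.trans_lt (not_le.1 h))), one_mul]
    · simp [hi]

end Paths

/-! ### Integrals against finite sums of unit jumps -/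

section Integral

variable {ι : Type*} [Fintype ι]

/-- The difference of the two stopped unit jumps tests whether `a i` lies in `(T j, T (j + 1)]`, so
summing over `j` evaluates the integrand at `a i`. The `c₀` term drops out because `a i > 0`. -/
lemma SimplePredictable.integral_sum_indicator (S : SimplePredictable 𝓕) (w : ι → ℝ)
    {a : ι → ℝ≥0} {s : ι → Set ℝ≥0} (ha : ∀ i, 0 < a i)
    (h₁ : ∀ i, Set.Ioi (a i) ⊆ s i) (h₂ : ∀ i, s i ⊆ Set.Ici (a i)) (t : ℝ≥0) (ω : Ω) :
    S.integral (fun t _ => ∑ i, w i * (s i).indicator (fun _ => (1 : ℝ)) t) t ω =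
      ∑ i, w i * (s i).indicator (fun _ => 1) t * S.eval (a i) ω := by
  simp only [SimplePredictable.integral, SimplePredictable.eval,
    stopAfter_sum_indicator w h₁ h₂]
  simp only [← Finset.sum_sub_distrib, Finset.mul_sum]
  rw [Finset.sum_comm]
  refine Finset.sum_congr rfl fun i _ => ?_
  have hzero : ({0} : Set ℝ≥0).indicator (fun _ => S.c₀ ω) (a i) = 0 :=
    Set.indicator_of_notMem (by simpa using (ha i).ne') _
  rw [hzero, zero_add, Finset.mul_sum]
  refine Finset.sum_congr rfl fun j _ => ?_
  have key : (Set.Ioc (S.T j ω) (S.T (j + 1) ω)).indicator (fun _ => S.c j ω) (a i) =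
      S.c j ω * ((Set.Ici (a i)).indicator (fun _ => 1) (S.T (j + 1) ω) -
        (Set.Ici (a i)).indicator (fun _ => 1) (S.T j ω)) := by
    have hm : S.T j ω ≤ S.T (j + 1) ω := S.mono_T ω j.le_succ
    simp only [Set.indicator_apply, Set.mem_Ioc, Set.mem_Ici]
    by_cases hj : a i ≤ S.T j ω
    · simp [hj, hj.trans hm, not_lt.2 hj]
    · simp [hj, not_le.1 hj]
  rw [key]
  ring

/-- The elementary integral against a convex combination of unit jumps is u.c.p. continuous. -/
lemma tendstoUCP_integral_sum_indicator {w : ι → ℝ} (hw₀ : ∀ i, 0 ≤ w i) (hw₁ : ∑ i, w i = 1)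
    {a : ι → ℝ≥0} {s : ι → Set ℝ≥0} (ha : ∀ i, 0 < a i)
    (h₁ : ∀ i, Set.Ioi (a i) ⊆ s i) (h₂ : ∀ i, s i ⊆ Set.Ici (a i)) {H : StochProcess Ω}
    {S : ℕ → SimplePredictable 𝓕} (hS : TendstoUCP μ (fun k => (S k).eval) H) :
    TendstoUCP μ
      (fun k => (S k).integral fun t _ => ∑ i, w i * (s i).indicator (fun _ => (1 : ℝ)) t)
      fun t ω => ∑ i, w i * (s i).indicator (fun _ => 1) t * H (a i) ω := by
  intro t ε hε
  refine tendsto_of_tendsto_of_tendsto_of_le_of_le tendsto_const_nhds (hS t ε hε)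
    (fun _ => zero_le) fun k => measure_mono ?_
  rintro ω ⟨u, hu, hle⟩
  -- The error at time `u` involves only integrand errors at jump times `a i ≤ u ≤ t`, so the bad
  -- event for the integrals lies in the one for the integrands.
  by_contra hcon
  simp only [Set.mem_ofPred_eq, not_exists, not_and, not_le] at hcon
  refine absurd hle (not_le.2 ?_)
  beta_reduce
  rw [SimplePredictable.integral_sum_indicator (S k) w ha h₁ h₂, ← Finset.sum_sub_distrib]
  simp only [← mul_sub]
  have hterm : ∀ i, |(s i).indicator (fun _ => (1 : ℝ)) u *
      ((S k).eval (a i) ω - H (a i) ω)| < ε := by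
    intro i
    by_cases hi : u ∈ s i
    · rw [Set.indicator_of_mem hi, one_mul]
      exact hcon _ ((h₂ i hi).trans hu)
    · simpa [hi] using hε
  have hbound : ∀ i, |w i * (s i).indicator (fun _ => (1 : ℝ)) u *
      ((S k).eval (a i) ω - H (a i) ω)| ≤ w i * ε := by
    intro i
    rw [mul_assoc, abs_mul, abs_of_nonneg (hw₀ i)]
    exact mul_le_mul_of_nonneg_left (hterm i).le (hw₀ i)
  -- The bad event is `≥ ε`, so the bound must be strict; one positive weight makes it so.
  obtain ⟨j, hj⟩ : ∃ j, 0 < w j := by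
    by_contra! hneg
    linarith [Finset.sum_nonpos fun i (_ : i ∈ Finset.univ) => hneg i]
  calc |∑ i, w i * (s i).indicator (fun _ => (1 : ℝ)) u * ((S k).eval (a i) ω - H (a i) ω)|
      ≤ ∑ i, |w i * (s i).indicator (fun _ => (1 : ℝ)) u *
          ((S k).eval (a i) ω - H (a i) ω)| := Finset.abs_sum_le_sum_abs _ _
    _ < ∑ i, w i * ε := by
        refine Finset.sum_lt_sum (fun i _ => hbound i) ⟨j, Finset.mem_univ _, ?_⟩
        rw [mul_assoc, abs_mul, abs_of_nonneg (hw₀ j)]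
        exact mul_lt_mul_of_pos_left (hterm j) hj
    _ = ε := by rw [← Finset.sum_mul, hw₁, one_mul]

/-- The deterministic simple predictable process `1_{(a, b]}`. -/
def SimplePredictable.ofIoc (𝓕 : Filtration ℝ≥0 m) {a b : ℝ≥0} (hab : a ≤ b) :
    SimplePredictable 𝓕 where
  n := 1
  T i _ := if i = 0 then a else b
  mono_T _ := by
    intro i j hij
    dsimp only
    split_ifs with hi hj hj
    · exact le_rfl
    · exact hab
    · omega
    · exact le_rfl
  stopping i := isStoppingTime_const 𝓕 _
  c₀ _ := 0
  measurable_c₀ := measurable_const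
  c _ _ := 1
  measurable_c _ := measurable_const

lemma SimplePredictable.eval_ofIoc {a b : ℝ≥0} (hab : a ≤ b) (t : ℝ≥0) (ω : Ω) :
    (SimplePredictable.ofIoc 𝓕 hab).eval t ω = (Set.Ioc a b).indicator (fun _ => 1) t := by
  simp [SimplePredictable.eval, SimplePredictable.ofIoc]

/-- The approximants `1_{(a, a + k]}` agree with the target on `[0, t]` as soon as `k ≥ t`. -/
lemma exists_tendstoUCP_indicator_Ioi (μ : Measure Ω) (𝓕 : Filtration ℝ≥0 m) (a : ℝ≥0) :
    ∃ S : ℕ → SimplePredictable 𝓕,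
      TendstoUCP μ (fun k => (S k).eval) fun t _ => (Set.Ioi a).indicator (fun _ => 1) t := by
  refine ⟨fun k => SimplePredictable.ofIoc 𝓕 (le_self_add : a ≤ a + k), fun t ε hε => ?_⟩
  refine tendsto_const_nhds.congr' ?_
  obtain ⟨K, hK⟩ := exists_nat_ge t
  filter_upwards [eventually_ge_atTop K] with k hk
  have hbound : t ≤ a + k := hK.trans ((Nat.cast_le.2 hk).trans le_add_self)
  symm
  convert measure_empty (μ := μ)
  ext ω
  simp only [Set.mem_ofPred_eq, Set.mem_empty_iff_false, iff_false, not_exists, not_and, not_le,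
    SimplePredictable.eval_ofIoc]
  intro u hu
  simpa [Set.indicator_apply, hu.trans hbound] using hε

/-- The Itô integral of `1_{(b, ∞)}` against a convex combination of unit jumps. -/
lemma isItoIntegral_sum_indicator (μ : Measure Ω) (𝓕 : Filtration ℝ≥0 m)
    {w : ι → ℝ} (hw₀ : ∀ i, 0 ≤ w i) (hw₁ : ∑ i, w i = 1)
    {a : ι → ℝ≥0} {s : ι → Set ℝ≥0} (ha : ∀ i, 0 < a i)
    (h₁ : ∀ i, Set.Ioi (a i) ⊆ s i) (h₂ : ∀ i, s i ⊆ Set.Ici (a i)) (b : ℝ≥0) :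
    IsItoIntegral 𝓕 μ (fun t _ => (Set.Ioi b).indicator (fun _ => 1) t)
      (fun t _ => ∑ i, w i * (s i).indicator (fun _ => (1 : ℝ)) t)
      fun t _ => ∑ i, w i * (s i).indicator (fun _ => 1) t *
        (Set.Ioi b).indicator (fun _ => 1) (a i) :=
  ⟨exists_tendstoUCP_indicator_Ioi μ 𝓕 b, fun _ hS =>
    tendstoUCP_integral_sum_indicator (H := fun t _ => (Set.Ioi b).indicator (fun _ => 1) t)
      hw₀ hw₁ ha h₁ h₂ hS⟩

end Integral

/-! ### Uniqueness of u.c.p. limits, integrals and Fatou limits -/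

section Uniqueness

lemma Indistinguishable.trans {X Y Z : StochProcess Ω} (h : Indistinguishable μ X Y)
    (h' : Indistinguishable μ Y Z) : Indistinguishable μ X Z := by
  filter_upwards [h, h'] with ω hω hω' t using (hω t).trans (hω' t)

/-- Triangle inequality with `ε / 2`, then a countable union over integer horizons and `ε = 1 / (n +
1)`. Only monotonicity and subadditivity of `μ` enter, so the events need not be measurable. -/
lemma TendstoUCP.indistinguishable {U : ℕ → StochProcess Ω} {Z Z' : StochProcess Ω}
    (h : TendstoUCP μ U Z) (h' : TendstoUCP μ U Z') : Indistinguishable μ Z Z' := by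
  have hnull : ∀ t : ℝ≥0, ∀ ε : ℝ, 0 < ε → μ {ω | ∃ s ≤ t, ε ≤ |Z s ω - Z' s ω|} = 0 := by
    intro t ε hε
    have hsum := (h t (ε / 2) (half_pos hε)).add (h' t (ε / 2) (half_pos hε))
    rw [add_zero] at hsum
    refine le_antisymm (ge_of_tendsto' hsum fun k => ?_) zero_le
    refine (measure_mono ?_).trans (measure_union_le _ _)
    rintro ω ⟨s, hs, hle⟩
    by_contra hcon
    simp only [Set.mem_union, Set.mem_ofPred_eq, not_or, not_exists, not_and, not_le] at hcon
    have h₁ := hcon.1 s hs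
    have h₂ := hcon.2 s hs
    rw [abs_sub_comm] at h₁
    have := abs_sub_le (Z s ω) (U k s ω) (Z' s ω)
    linarith
  have hall : ∀ᵐ ω ∂μ, ∀ t n : ℕ, ¬ ∃ s ≤ (t : ℝ≥0), 1 / ((n : ℝ) + 1) ≤ |Z s ω - Z' s ω| := by
    refine ae_all_iff.2 fun t => ae_all_iff.2 fun n => ?_
    rw [ae_iff]
    simpa only [not_not] using hnull t _ Nat.one_div_pos_of_nat
  filter_upwards [hall] with ω hω t
  by_contra hne
  obtain ⟨N, hN⟩ := exists_nat_ge t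
  obtain ⟨n, hn⟩ := exists_nat_one_div_lt (abs_pos.2 (sub_ne_zero.2 hne))
  exact hω N n ⟨t, hN, hn.le⟩

lemma IsItoIntegral.indistinguishable {H A Z Z' : StochProcess Ω}
    (h : IsItoIntegral 𝓕 μ H A Z) (h' : IsItoIntegral 𝓕 μ H A Z') : Indistinguishable μ Z Z' :=
  have ⟨S, hS⟩ := h.1
  (h.2 S hS).indistinguishable (h'.2 S hS)

lemma TendstoUCP.congr_left {U V : ℕ → StochProcess Ω} {Z : StochProcess Ω}
    (h : TendstoUCP μ U Z) (hUV : ∀ k, Indistinguishable μ (U k) (V k)) : TendstoUCP μ V Z := by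
  intro t ε hε
  refine (h t ε hε).congr fun k => measure_congr (eventuallyEq_set.2 ?_)
  filter_upwards [hUV k] with ω hω
  simp only [hω]

lemma Indistinguishable.integral {A B : StochProcess Ω} (h : Indistinguishable μ A B)
    (S : SimplePredictable 𝓕) : Indistinguishable μ (S.integral A) (S.integral B) := by
  filter_upwards [h] with ω hω t
  have : (fun s => A s ω) = fun s => B s ω := funext hω
  simp only [SimplePredictable.integral, this]

lemma IsItoIntegral.congr_integrator {H A B Z : StochProcess Ω}
    (h : IsItoIntegral 𝓕 μ H A Z) (hAB : Indistinguishable μ A B) : IsItoIntegral 𝓕 μ H B Z :=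
  ⟨h.1, fun S hS => (h.2 S hS).congr_left fun k => hAB.integral (S k)⟩

/-- Rationals accumulate at `t` from the right, which makes rational right limits unique. -/
instance comap_nnratCast_nhdsGT_neBot (t : ℝ≥0) :
    (comap (fun q : ℚ≥0 => (q : ℝ≥0)) (𝓝[>] t)).NeBot := by
  refine comap_neBot fun s hs => ?_
  obtain ⟨u, hu, hsub⟩ := (mem_nhdsGT_iff_exists_Ioo_subset).1 hs
  obtain ⟨q, hq₁, hq₂⟩ := exists_rat_btwn (NNReal.coe_lt_coe.2 hu)
  have hq : 0 ≤ q := by exact_mod_cast t.coe_nonneg.trans hq₁.le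
  lift q to ℚ≥0 using hq
  exact ⟨q, hsub ⟨by exact_mod_cast hq₁,
    by exact_mod_cast hq₂⟩⟩

lemma IsRationalRightLimit.indistinguishable {ξ ξ' : ℚ≥0 → Ω → ℝ} {L L' : StochProcess Ω}
    (h : IsRationalRightLimit μ ξ L) (h' : IsRationalRightLimit μ ξ' L')
    (hξ : ∀ q, ξ q =ᵐ[μ] ξ' q) : Indistinguishable μ L L' := by
  filter_upwards [h, h', ae_all_iff.2 hξ] with ω h₁ h₂ h₃ t
  exact tendsto_nhds_unique (h₁ t) ((h₂ t).congr fun q => (h₃ q).symm)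

lemma IsFatouLimit.indistinguishable {U : ℕ+ → StochProcess Ω} {L L' : StochProcess Ω}
    (h : IsFatouLimit μ U L) (h' : IsFatouLimit μ U L') : Indistinguishable μ L L' := by
  obtain ⟨ξ, hξ, hL⟩ := h
  obtain ⟨ξ', hξ', hL'⟩ := h'
  refine hL.indistinguishable hL' fun q => ?_
  filter_upwards [hξ q, hξ' q] with ω h₁ h₂ using tendsto_nhds_unique h₁ h₂

lemma IsFatouLimitInProbability.indistinguishable {U : ℕ+ → StochProcess Ω}
    {L L' : StochProcess Ω} (h : IsFatouLimitInProbability μ U L)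
    (h' : IsFatouLimitInProbability μ U L') : Indistinguishable μ L L' := by
  obtain ⟨ξ, hξ, hL⟩ := h
  obtain ⟨ξ', hξ', hL'⟩ := h'
  exact hL.indistinguishable hL' fun q => tendstoInMeasure_ae_unique (hξ q) (hξ' q)

lemma IsFatouLimit.congr {U V : ℕ+ → StochProcess Ω} {L : StochProcess Ω}
    (h : IsFatouLimit μ U L) (hUV : ∀ n, Indistinguishable μ (U n) (V n)) :
    IsFatouLimit μ V L := by
  obtain ⟨ξ, hξ, hL⟩ := h
  refine ⟨ξ, fun q => ?_, hL⟩
  filter_upwards [hξ q, ae_all_iff.2 hUV] with ω h₁ h₂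
  exact h₁.congr fun n => h₂ n _

lemma IsFatouLimit.inProbability [IsFiniteMeasure μ] {U : ℕ+ → StochProcess Ω}
    {L : StochProcess Ω} (h : IsFatouLimit μ U L)
    (hU : ∀ n t, AEStronglyMeasurable (U n t) μ) : IsFatouLimitInProbability μ U L := by
  obtain ⟨ξ, hξ, hL⟩ := h
  refine ⟨ξ, fun q ε hε => ?_, hL⟩
  -- Almost sure convergence gives convergence in measure along `ℕ`; `PNat.natPred` carries it back
  -- to `ℕ+`.
  have hseq : TendstoInMeasure μ (fun k : ℕ => U k.succPNat (q : ℝ≥0)) atTop (ξ q) := by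
    refine tendstoInMeasure_of_tendsto_ae (fun k => hU _ _) ?_
    filter_upwards [hξ q] with ω hω
    exact hω.comp (tendsto_atTop_atTop.2 fun n => ⟨n, fun k hk => by
      rw [← PNat.coe_le_coe]; exact hk.trans k.le_succ⟩)
  have hpred : Tendsto PNat.natPred atTop atTop :=
    tendsto_atTop_atTop.2 fun n => ⟨n.succPNat, fun k hk => by
      have := PNat.natPred_monotone hk
      simpa using this⟩
  refine ((hseq ε hε).comp hpred).congr fun n => ?_
  simp

end Uniqueness

/-! ### Step processes and their forward convex combinations -/

section StepProcess

lemma isCadlagAdapted_stepProcess (𝓕 : Filtration ℝ≥0 m) (a : ℝ≥0) :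
    IsCadlagAdapted 𝓕 (stepProcess Ω a) :=
  ⟨fun _ => stronglyMeasurable_const, fun _ => isCadlag_indicator_Ici a⟩

lemma isFiniteVariation_stepProcess (𝓕 : Filtration ℝ≥0 m) (a : ℝ≥0) :
    IsFiniteVariation 𝓕 (stepProcess Ω a) :=
  ⟨isCadlagAdapted_stepProcess 𝓕 a, fun _ =>
    ((monotone_indicator_Ici a).monotoneOn _).locallyBoundedVariationOn⟩

lemma isLocalMartingale_zero (𝓕 : Filtration ℝ≥0 m) (μ : Measure Ω) :
    IsLocalMartingale 𝓕 μ (0 : StochProcess Ω) where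
  adapted _ := stronglyMeasurable_const
  cadlag _ _ := ⟨continuousWithinAt_const, 0, tendsto_const_nhds⟩
  locally_martingale := Locally.of_prop (martingale_zero ℝ 𝓕 μ)

lemma isSemimartingale_stepProcess (𝓕 : Filtration ℝ≥0 m) (μ : Measure Ω) (a : ℝ≥0) :
    IsSemimartingale 𝓕 μ (stepProcess Ω a) :=
  ⟨isCadlagAdapted_stepProcess 𝓕 a, 0, stepProcess Ω a, isLocalMartingale_zero 𝓕 μ,
    isFiniteVariation_stepProcess 𝓕 a, by simp [Indistinguishable]⟩

lemma totalVariation_stepProcess_le (a : ℝ≥0) (ω : Ω) :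
    totalVariation (stepProcess Ω a) ω ≤ 1 := by
  have hm := monotone_indicator_Ici a
  refine iSup_le fun ⟨n, u, hu, _⟩ => ?_
  calc ∑ i ∈ Finset.range n, edist (stepProcess Ω a (u (i + 1)) ω) (stepProcess Ω a (u i) ω)
      ≤ eVariationOn ((Set.Ici a).indicator fun _ => (1 : ℝ)) (Set.univ ∩ Set.Icc (u 0) (u n)) :=
        eVariationOn.sum_le_of_monotoneOn_Iic (hu.monotoneOn _)
          fun i hi => ⟨trivial, hu i.zero_le, hu hi⟩
    _ = ENNReal.ofReal _ := (hm.monotoneOn _).eVariationOn_eq trivial trivial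
    _ ≤ ENNReal.ofReal 1 := by
        refine ENNReal.ofReal_le_ofReal ?_
        have h₀ : 0 ≤ (Set.Ici a).indicator (fun _ => (1 : ℝ)) (u 0) :=
          Set.indicator_nonneg (fun _ _ => zero_le_one) _
        have h₁ : (Set.Ici a).indicator (fun _ => (1 : ℝ)) (u n) ≤ 1 :=
          Set.indicator_le_self' (fun _ _ => zero_le_one) _
        linarith
    _ = 1 := ENNReal.ofReal_one

lemma leftLimProcess_stepProcess {a : ℝ≥0} (ha : 0 < a) :
    leftLimProcess (stepProcess Ω a) = fun t _ => (Set.Ioi a).indicator (fun _ => 1) t := by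
  funext t ω
  have := leftLim_sum_indicator_Ici (ι := Unit) (fun _ => 1) (a := fun _ => a) (fun _ => ha) t
  simpa [leftLimProcess, stepProcess] using this

/-- The integral of `Y₋` against `Y` vanishes for `Y = 1_{[a, ∞)}`. -/
lemma isItoIntegral_stepProcess_self (μ : Measure Ω) (𝓕 : Filtration ℝ≥0 m) {a : ℝ≥0}
    (ha : 0 < a) :
    IsItoIntegral 𝓕 μ (leftLimProcess (stepProcess Ω a)) (stepProcess Ω a) 0 := by
  have := isItoIntegral_sum_indicator (ι := Unit) μ 𝓕 (w := fun _ => 1) (fun _ => zero_le_one)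
    (by simp) (a := fun _ => a) (s := fun _ => Set.Ici a) (fun _ => ha)
    (fun _ => Set.Ioi_subset_Ici_self) (fun _ => subset_rfl) a
  rw [leftLimProcess_stepProcess ha]
  -- The only jump is at `a`, and `a ∉ (a, ∞)`; this is why the integral vanishes.
  simp only [Finset.univ_unique, Finset.sum_singleton, one_mul,
    Set.indicator_of_notMem Set.self_notMem_Ioi, mul_zero] at this
  exact this

lemma exists_of_isForwardConvexCombination {X Xt : ℕ+ → StochProcess Ω}
    (hX : ∀ n : ℕ+, X n = stepProcess Ω (1 + 1 / (n : ℝ≥0)))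
    (hXt : IsForwardConvexCombination X Xt) (n : ℕ+) :
    ∃ (ι : Type) (_ : Fintype ι) (w : ι → ℝ) (a : ι → ℝ≥0), (∀ i, 0 ≤ w i) ∧ ∑ i, w i = 1 ∧
      (∀ i, 1 < a i ∧ a i ≤ 1 + 1 / (n : ℝ≥0)) ∧
      Xt n = fun t _ => ∑ i, w i * (Set.Ici (a i)).indicator (fun _ => (1 : ℝ)) t := by
  obtain ⟨ι, _, w, z, hw₀, hw₁, hz, hsum⟩ := mem_convexHull_iff_exists_fintype.1 (hXt n)
  choose k hk hkz using hz
  refine ⟨ι, inferInstance, w, fun i => 1 + 1 / (k i : ℝ≥0), hw₀, hw₁, fun i => ⟨?_, ?_⟩, ?_⟩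
  · have : (0 : ℝ≥0) < (k i : ℝ≥0) := by exact_mod_cast (k i).pos
    exact lt_add_of_pos_right _ (by positivity)
  · have h0 : (0 : ℝ≥0) < (n : ℝ≥0) := by exact_mod_cast n.pos
    have h1 : (n : ℝ≥0) ≤ (k i : ℝ≥0) := by exact_mod_cast hk i
    exact add_le_add_right (one_div_le_one_div_of_le h0 h1) _
  · rw [← hsum]
    funext t ω
    simp [Finset.sum_apply, ← hkz, hX, stepProcess]

/-- Deterministic paths that climb from `0` to `1` in shrinking intervals to the right of `1` have
the Fatou limit `1_{[1, ∞)}`. -/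
lemma isFatouLimit_stepProcess (μ : Measure Ω) {V : ℕ+ → StochProcess Ω}
    (h₀ : ∀ n t ω, t ≤ 1 → V n t ω = 0)
    (h₁ : ∀ (n : ℕ+) t ω, 1 + 1 / (n : ℝ≥0) < t → V n t ω = 1) :
    IsFatouLimit μ V (stepProcess Ω 1) := by
  -- The pointwise limit is `1_{(1, ∞)}`, as every `V n` vanishes at `1`; the right limit over
  -- rationals restores the value `1` there.
  refine ⟨fun q _ => (Set.Ioi 1).indicator (fun _ => 1) (q : ℝ≥0), fun q => ?_, ?_⟩
  · refine Eventually.of_forall fun ω => tendsto_const_nhds.congr' ?_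
    by_cases hq : 1 < (q : ℝ≥0)
    · obtain ⟨N, hN⟩ := exists_nat_one_div_lt (tsub_pos_of_lt hq)
      filter_upwards [eventually_ge_atTop N.succPNat] with n hn
      rw [Set.indicator_of_mem (Set.mem_Ioi.2 hq), h₁ n _ ω]
      have hn' : (N : ℝ≥0) + 1 ≤ (n : ℝ≥0) := by
        have : N + 1 ≤ (n : ℕ) := hn
        exact_mod_cast this
      have : 1 / (n : ℝ≥0) ≤ 1 / ((N : ℝ≥0) + 1) := by gcongr
      rw [add_comm]
      exact lt_tsub_iff_right.1 (this.trans_lt hN)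
    · refine Eventually.of_forall fun n => ?_
      beta_reduce
      rw [Set.indicator_of_notMem (show (q : ℝ≥0) ∉ Set.Ioi 1 from hq), h₀ n _ ω (not_lt.1 hq)]
  · exact Eventually.of_forall fun ω t =>
      (tendsto_indicator_nhdsGT subset_rfl Set.Ioi_subset_Ici_self t).comp tendsto_comap

lemma sum_indicator_Ici_eq {ι : Type*} [Fintype ι] {w : ι → ℝ} {a : ι → ℝ≥0}
    {s : ι → Set ℝ≥0} (hw₁ : ∑ i, w i = 1) (h₁ : ∀ i, Set.Ioi (a i) ⊆ s i)
    (h₂ : ∀ i, s i ⊆ Set.Ici (a i)) {b c : ℝ≥0} (hbc : ∀ i, b < a i ∧ a i ≤ c) (t : ℝ≥0) :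
    (t ≤ b → ∑ i, w i * (s i).indicator (fun _ => (1 : ℝ)) t = 0) ∧
      (c < t → ∑ i, w i * (s i).indicator (fun _ => (1 : ℝ)) t = 1) := by
  refine ⟨fun ht => Finset.sum_eq_zero fun i _ => ?_, fun ht => ?_⟩
  · rw [Set.indicator_of_notMem, mul_zero]
    exact fun h => absurd (h₂ i h) (not_le.2 (ht.trans_lt (hbc i).1))
  · refine Eq.trans ?_ hw₁
    refine Finset.sum_congr rfl fun i _ => ?_
    rw [Set.indicator_of_mem (h₁ i ((hbc i).2.trans_lt ht)), mul_one]

/-- If `A` jumps only after time `1`, then integrating `1_{(1, ∞)}` against `A` returns `A`. -/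
lemma isItoIntegral_sum_indicator_self (μ : Measure Ω) (𝓕 : Filtration ℝ≥0 m)
    {ι : Type*} [Fintype ι] {w : ι → ℝ} (hw₀ : ∀ i, 0 ≤ w i) (hw₁ : ∑ i, w i = 1)
    {a : ι → ℝ≥0} {s : ι → Set ℝ≥0} (ha : ∀ i, 1 < a i)
    (h₁ : ∀ i, Set.Ioi (a i) ⊆ s i) (h₂ : ∀ i, s i ⊆ Set.Ici (a i)) :
    IsItoIntegral 𝓕 μ (leftLimProcess (stepProcess Ω 1))
      (fun t _ => ∑ i, w i * (s i).indicator (fun _ => (1 : ℝ)) t)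
      fun t _ => ∑ i, w i * (s i).indicator (fun _ => (1 : ℝ)) t := by
  have := isItoIntegral_sum_indicator μ 𝓕 hw₀ hw₁ (fun i => zero_lt_one.trans (ha i)) h₁ h₂ 1
  rw [leftLimProcess_stepProcess zero_lt_one]
  simpa [ha] using this

/-- The properties shared by `Xt n` and its left limits. -/
structure IsSelfIntegratingStep (𝓕 : Filtration ℝ≥0 m) (μ : Measure Ω) (c : ℝ≥0)
    (V : StochProcess Ω) : Prop where
  integral : IsItoIntegral 𝓕 μ (leftLimProcess (stepProcess Ω 1)) V V
  eq_zero : ∀ t ω, t ≤ 1 → V t ω = 0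
  eq_one : ∀ t ω, c < t → V t ω = 1
  deterministic : ∀ t, ∃ v : ℝ, V t = fun _ => v

lemma isSelfIntegratingStep_sum_indicator (μ : Measure Ω) (𝓕 : Filtration ℝ≥0 m)
    {ι : Type*} [Fintype ι] {w : ι → ℝ} (hw₀ : ∀ i, 0 ≤ w i) (hw₁ : ∑ i, w i = 1)
    {a : ι → ℝ≥0} {s : ι → Set ℝ≥0} {c : ℝ≥0} (ha : ∀ i, 1 < a i ∧ a i ≤ c)
    (h₁ : ∀ i, Set.Ioi (a i) ⊆ s i) (h₂ : ∀ i, s i ⊆ Set.Ici (a i)) :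
    IsSelfIntegratingStep 𝓕 μ c
      fun t _ => ∑ i, w i * (s i).indicator (fun _ => (1 : ℝ)) t where
  integral := isItoIntegral_sum_indicator_self μ 𝓕 hw₀ hw₁ (fun i => (ha i).1) h₁ h₂
  eq_zero t _ := (sum_indicator_Ici_eq hw₁ h₁ h₂ ha t).1
  eq_one t _ := (sum_indicator_Ici_eq hw₁ h₁ h₂ ha t).2
  deterministic _ := ⟨_, rfl⟩

lemma IsForwardConvexCombination.isSelfIntegratingStep (μ : Measure Ω) (𝓕 : Filtration ℝ≥0 m)
    {X Xt : ℕ+ → StochProcess Ω} (hX : ∀ n : ℕ+, X n = stepProcess Ω (1 + 1 / (n : ℝ≥0)))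
    (hXt : IsForwardConvexCombination X Xt) (n : ℕ+) :
    IsSelfIntegratingStep 𝓕 μ (1 + 1 / (n : ℝ≥0)) (Xt n) ∧
      IsSelfIntegratingStep 𝓕 μ (1 + 1 / (n : ℝ≥0)) (leftLimProcess (Xt n)) := by
  obtain ⟨ι, _, w, a, hw₀, hw₁, ha, hrep⟩ := exists_of_isForwardConvexCombination hX hXt n
  have hleft : leftLimProcess (Xt n) =
      fun t _ => ∑ i, w i * (Set.Ioi (a i)).indicator (fun _ => (1 : ℝ)) t := by
    funext t ω
    rw [hrep]
    exact leftLim_sum_indicator_Ici w (fun i => zero_lt_one.trans (ha i).1) t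
  rw [hleft, hrep]
  exact ⟨isSelfIntegratingStep_sum_indicator μ 𝓕 hw₀ hw₁ ha (fun _ => Set.Ioi_subset_Ici_self)
    fun _ => subset_rfl, isSelfIntegratingStep_sum_indicator μ 𝓕 hw₀ hw₁ ha (fun _ => subset_rfl)
    fun _ => Set.Ioi_subset_Ici_self⟩

lemma not_indistinguishable_stepProcess_zero [NeZero μ] (a : ℝ≥0) :
    ¬ Indistinguishable μ (stepProcess Ω a) 0 := by
  intro h
  obtain ⟨ω, hω⟩ := h.exists
  simpa [stepProcess] using hω a

/-- Each `I n` is a version of `V n` itself, so it inherits the Fatou limit of `V`. -/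
lemma isFatouLimit_integral {V I : ℕ+ → StochProcess Ω}
    (hV : ∀ n : ℕ+, IsSelfIntegratingStep 𝓕 μ (1 + 1 / (n : ℝ≥0)) (V n))
    (hI : ∀ n, IsItoIntegral 𝓕 μ (leftLimProcess (stepProcess Ω 1)) (V n) (I n)) :
    IsFatouLimit μ I (stepProcess Ω 1) :=
  (isFatouLimit_stepProcess μ (fun n => (hV n).eq_zero) fun n => (hV n).eq_one).congr
    fun n => (hV n).integral.indistinguishable (hI n)

lemma not_indistinguishable_integral_self [NeZero μ] {J : StochProcess Ω}
    (hJ : IsItoIntegral 𝓕 μ (leftLimProcess (stepProcess Ω 1)) (stepProcess Ω 1) J) :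
    ¬ Indistinguishable μ (stepProcess Ω 1) J := fun h =>
  not_indistinguishable_stepProcess_zero 1
    (h.trans (hJ.indistinguishable (isItoIntegral_stepProcess_self μ 𝓕 zero_lt_one)))

end StepProcess

end FatouIto

theorem theorem3 {Ω : Type*} {m : MeasurableSpace Ω} (μ : Measure Ω) [IsProbabilityMeasure μ]
    (𝓕 : Filtration ℝ≥0 m) (h𝓕 : UsualConditions 𝓕 μ) :
    ∃ (Y : StochProcess Ω) (X : ℕ+ → StochProcess Ω),
      -- the explicit choice of `Y` and `X`; they are semimartingales, and each `X n` starts at zero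
      Y = stepProcess Ω 1 ∧
      (∀ n : ℕ+, X n = stepProcess Ω (1 + 1 / (n : ℝ≥0))) ∧
      IsSemimartingale 𝓕 μ Y ∧
      (∀ n, IsSemimartingale 𝓕 μ (X n)) ∧
      (∀ n ω, X n 0 ω = 0) ∧
      -- the total variations are bounded in expectation
      (⨆ n, ∫⁻ ω, totalVariation (X n) ω ∂μ) ≤ 1 ∧
      ∀ Xt : ℕ+ → StochProcess Ω, IsForwardConvexCombination X Xt →
        -- `Y` is the Fatou limit
        IsFatouLimit μ Xt Y ∧
        -- the integral of `Y₋` against `Y` exists, and so do those against `Xt n` and `(Xt n)₋`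
        (∃ J, IsItoIntegral 𝓕 μ (leftLimProcess Y) Y J) ∧
        (∀ n, ∃ I, IsItoIntegral 𝓕 μ (leftLimProcess Y) (leftLimProcess (Xt n)) I) ∧
        (∀ n, ∃ I, IsItoIntegral 𝓕 μ (leftLimProcess Y) (Xt n) I) ∧
        -- the limit of the integrals of `Y₋` against `(Xt n)₋` is not the integral against `Y`
        (∀ (I : ℕ+ → StochProcess Ω) (J : StochProcess Ω),
          (∀ n, IsItoIntegral 𝓕 μ (leftLimProcess Y) (leftLimProcess (Xt n)) (I n)) →
          IsItoIntegral 𝓕 μ (leftLimProcess Y) Y J →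
          ∃ L, IsFatouLimit μ I L ∧ ¬ Indistinguishable μ L J) ∧
        -- the same for the integrals of `Y₋` against `Xt n`
        (∀ (I : ℕ+ → StochProcess Ω) (J : StochProcess Ω),
          (∀ n, IsItoIntegral 𝓕 μ (leftLimProcess Y) (Xt n) (I n)) →
          IsItoIntegral 𝓕 μ (leftLimProcess Y) Y J →
          ∃ L, IsFatouLimit μ I L ∧ ¬ Indistinguishable μ L J) ∧
        -- no semimartingale limit `Z` commutes with integration of `Y₋`, even in probability
        ¬ ∃ (Z : StochProcess Ω) (I : ℕ+ → StochProcess Ω) (J : StochProcess Ω),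
          IsSemimartingale 𝓕 μ Z ∧
          IsFatouLimit μ Xt Z ∧
          (∀ n, IsItoIntegral 𝓕 μ (leftLimProcess Y) (Xt n) (I n)) ∧
          IsItoIntegral 𝓕 μ (leftLimProcess Y) Z J ∧
          IsFatouLimitInProbability μ I J := by
  refine ⟨stepProcess Ω 1, fun n => stepProcess Ω (1 + 1 / (n : ℝ≥0)), rfl, fun _ => rfl,
    isSemimartingale_stepProcess 𝓕 μ 1, fun n => isSemimartingale_stepProcess 𝓕 μ _,
    fun n ω => ?_, ?_, fun Xt hXt => ?_⟩
  · exact Set.indicator_of_notMem (not_le.2 (zero_lt_one.trans_le le_self_add)) _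
  · refine iSup_le fun n => (lintegral_mono fun ω => totalVariation_stepProcess_le _ ω).trans ?_
    simp
  have hV := fun n => (hXt.isSelfIntegratingStep μ 𝓕 (fun _ => rfl) n).1
  have hW := fun n => (hXt.isSelfIntegratingStep μ 𝓕 (fun _ => rfl) n).2
  have hY : IsFatouLimit μ Xt (stepProcess Ω 1) :=
    isFatouLimit_stepProcess μ (fun n => (hV n).eq_zero) fun n => (hV n).eq_one
  refine ⟨hY, ⟨0, isItoIntegral_stepProcess_self μ 𝓕 zero_lt_one⟩, fun n => ⟨_, (hW n).integral⟩,
    fun n => ⟨_, (hV n).integral⟩,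
    fun I J hI hJ => ⟨_, isFatouLimit_integral hW hI, not_indistinguishable_integral_self hJ⟩,
    fun I J hI hJ => ⟨_, isFatouLimit_integral hV hI, not_indistinguishable_integral_self hJ⟩, ?_⟩
  rintro ⟨Z, I, J, -, hZ, hI, hJ, hIJ⟩
  -- Uniqueness of Fatou limits identifies `Z` with `Y`, so `J` is a version of `∫ Y₋ dY`, while the
  -- integrals `I n` converge to `Y`.
  refine not_indistinguishable_integral_self
    (hJ.congr_integrator (hZ.indistinguishable hY)) ?_
  refine IsFatouLimitInProbability.indistinguishable ?_ hIJ
  refine (isFatouLimit_integral hV hI).inProbability fun n t => ?_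
  -- `IsItoIntegral` carries no measurability of `I n`; it comes from almost sure equality with a
  -- deterministic process.
  obtain ⟨v, hv⟩ := (hV n).deterministic t
  refine (aestronglyMeasurable_const (b := v)).congr ?_
  filter_upwards [(hV n).integral.indistinguishable (hI n)] with ω hω
  rw [← hω t, hv]
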